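/- Let $\mathbb K$ be a field of characteristic zero and let $H_{CK}=\mathbb K[\mathcal T]$ be the Connes–Kreimer Hopf algebra of (non-empty, non-planar) rooted trees, with coproduct $\Delta(t)=t\otimes 1+1\otimes t+\sum_{c}P^c(t)\otimes R^c(t)$ for trees $t$, where $c$ runs over the non-empty admissible cuts of $t$, $R^c(t)$ is the part containing the root and $P^c(t)$ is the forest of the other parts. Let $N(t)=\sum_{v\in \mathrm{Vert}(t)}N_v(t)$ be the natural growth operator, where $N_v(t)$ is $t$ with a new leaf attached to the vertex $v$, and let $t_1=\bullet$, $t_{n+1}=N(t_n)$ $(n\ge 1)$ be the Connes–Moscovici generators. **Lemma.** 1. The $t_n$ $(n\geq 1)$ are algebraically independent, and with $A=\mathbb K[t_1,t_2,\dots]$ we have $\Delta(t_n)\in A\otimes A$ for all $n\ge1$. For $i,j\ge 1$ let $\lambda_{i,j}$ be the coefficient of $t_j\otimes t_i$ in $\Delta(t_{i+j})$, written in the basis of $A\otimes A$ formed by the tensors of monomials in the $t_n$. Then $$\lambda_{i,j}=\binom{i+j}{j+1}\qquad(i,j\ge 1).$$ 2. Let $\phi:H_{CK}\to\mathbb K[L]$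 be Feynman rules, that is, a Hopf algebra morphism, where $\Delta(L)=L\otimes1+1\otimes L$ in $\mathbb K[L]$. Suppose that $\phi(t_n)\neq0$ for at least one $n\ge1$. Then the Green function $G(x,L)=\phi\big(1+\sum_{n\ge1}t_nx^n\big)=1+\sum_{n\ge1}\phi(t_n)x^n\in\mathbb K[L][[x]]$ does not satisfy any first-order renormalization group equation, homogeneous or not: there are no formal power series $\beta,\gamma,\gamma_0\in\mathbb K[[x]]$ with $$\Big(\frac{\partial}{\partial L}+\beta(x)\frac{\partial}{\partial x}-\gamma(x)\Big)G(x,L)=\gamma_0(x).$$ -/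

import Mathlib

open scoped TensorProduct

noncomputable section

/-! ### Rooted trees without plane structure -/

/-- Finite multisets as a quotient of the polynomial functor `α ↦ Σ n, (Fin n → α)`. -/
instance instQPFMultiset : QPF Multiset.{0} where
  toFunctor := Multiset.functor
  P := ⟨ℕ, Fin⟩
  abs := fun p => Multiset.ofList (List.ofFn p.2)
  repr := fun s => ⟨s.toList.length, s.toList.get⟩
  abs_repr := by
    intro α s
    change ((List.ofFn s.toList.get : List α) : Multiset α) = s
    rw [List.ofFn_get, Multiset.coe_toList]
  abs_map := by
    rintro α β f ⟨n, g⟩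
    change ((List.ofFn (f ∘ g) : List β) : Multiset β) = Multiset.map f (List.ofFn g : List α)
    rw [Multiset.map_coe, List.map_ofFn]

/-- Non-empty finite rooted trees without plane structure: the initial algebra of the functor
`Multiset`. A tree is the same thing as the finite multiset of the subtrees hanging from its
root. -/
def RTree : Type := QPF.Fix Multiset

namespace RTree

/-- The tree whose root has the given multiset of trees as its branches. -/
def node (s : Multiset RTree) : RTree := QPF.Fix.mk s

/-- Induction on rooted trees. -/
theorem induction {p : RTree → Prop} (h : ∀ s : Multiset RTree, (∀ t ∈ s, p t) → p (node s))
    (t : RTree) : p t := by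
  refine QPF.Fix.ind p ?_ t
  intro s hs
  refine h s ?_
  obtain ⟨u, hu⟩ := hs
  intro t ht
  rw [← hu] at ht
  obtain ⟨a, -, rfl⟩ := Multiset.mem_map.1 ht
  exact a.2

/-- Recursion on rooted trees: the value at a tree is computed from its branches together with
the values at these branches (see `RTree.fold_node`). -/
def fold {α : Type} (f : Multiset (RTree × α) → α) (t : RTree) : α :=
  (QPF.Fix.rec (F := Multiset) (α := RTree × α) (fun m => (node (m.map Prod.fst), f m)) t).2

theorem fold_node {α : Type} (f : Multiset (RTree × α) → α) (s : Multiset RTree) :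
    fold f (node s) = f (s.map fun t => (t, fold f t)) := by
  let g : Multiset (RTree × α) → RTree × α := fun m => (node (m.map Prod.fst), f m)
  let r : RTree → RTree × α := QPF.Fix.rec (F := Multiset) g
  have hrec : ∀ s : Multiset RTree, r (node s) = g (s.map r) := fun s => QPF.Fix.rec_eq g s
  have hfst : ∀ t : RTree, (r t).1 = t := by
    intro t
    induction t using RTree.induction with
    | h s ih =>
      rw [hrec]
      change node ((s.map r).map Prod.fst) = node s
      rw [Multiset.map_map]
      congr 1
      conv_rhs => rw [← Multiset.map_id s]
      exact Multiset.map_congr rfl fun t ht => ih t ht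
  change (r (node s)).2 = _
  rw [hrec]
  change f _ = f _
  congr 1
  refine Multiset.map_congr rfl fun t _ => ?_
  exact Prod.ext (hfst t) rfl

/-- The tree `•` with a single vertex. -/
def bullet : RTree := node 0

/-- The possibilities for an admissible cut along one branch `t` of a tree, given the admissible
cuts of `t`: either the edge from the root to the branch is cut (then all of `t` is pruned,
nothing of `t` stays at the root, and no other edge of `t` may be cut), or it is not cut, and the
cut restricts to a (possibly empty) admissible cut of `t`. -/
def branchCuts (p : RTree × Multiset (Multiset RTree × RTree)) :
    Multiset (Multiset RTree × Multiset RTree) :=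
  ({p.1}, 0) ::ₘ p.2.map fun c => (c.1, {c.2})

/-- The multiset of all pairs `(Pᶜ(t), Rᶜ(t))`, where `c` runs over the admissible cuts of `t`,
the empty cut (with `P = 0`, the empty forest, and `R = t`) included. A cut of a tree is an
independent choice of one of the possibilities `branchCuts` for each branch at the root
(see `RTree.cuts_node`). -/
def cuts : RTree → Multiset (Multiset RTree × RTree) :=
  fold fun m => (m.map branchCuts).Sections.map fun c => (c.sum.1, node c.sum.2)

theorem cuts_node (s : Multiset RTree) :
    cuts (node s) = (s.map fun t => branchCuts (t, cuts t)).Sections.map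
      fun c => (c.sum.1, node c.sum.2) := by
  rw [cuts, fold_node, Multiset.map_map]
  rfl

open Classical in
/-- The multiset of the trees `N_v(t)`, where `v` runs over the vertices of `t` and `N_v(t)` is
obtained from `t` by adding a new leaf with parent `v`: either `v` is the root, or it is a vertex
of one of the branches at the root (see `RTree.grafts_node`). -/
def grafts : RTree → Multiset RTree :=
  fold fun m => node (bullet ::ₘ m.map Prod.fst) ::ₘ
    m.bind fun p => p.2.map fun u => node (u ::ₘ (m.map Prod.fst).erase p.1)

open Classical in
theorem grafts_node (s : Multiset RTree) :
    grafts (node s) = node (bullet ::ₘ s) ::ₘ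
      s.bind fun t => (grafts t).map fun u => node (u ::ₘ s.erase t) := by
  rw [grafts, fold_node, Multiset.bind_map, Multiset.map_map]
  simp only [Function.comp_def, Multiset.map_id']

end RTree

/-! ### The Connes–Kreimer Hopf algebra -/

/-- The algebra `K[𝒯]`; the monomials are the rooted forests. -/
abbrev HCK (K : Type*) [Field K] : Type _ := MvPolynomial RTree K

namespace HCK

variable (K : Type*) [Field K]

/-- A tree as an element of `H_CK`. -/
def tree (t : RTree) : HCK K := MvPolynomial.X t

/-- A forest as an element of `H_CK`: the product of its trees. -/
def forest (s : Multiset RTree) : HCK K := (s.map (tree K)).prod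

/-- The coproduct: the algebra homomorphism with
`Δ(t) = t ⊗ 1 + ∑ Pᶜ(t) ⊗ Rᶜ(t)` for trees `t`. The sum runs over all admissible cuts of `t`,
the empty cut, which contributes `1 ⊗ t`, included. -/
def comul : HCK K →ₐ[K] HCK K ⊗[K] HCK K :=
  MvPolynomial.aeval fun t =>
    tree K t ⊗ₜ[K] 1 + (t.cuts.map fun c => forest K c.1 ⊗ₜ[K] tree K c.2).sum

/-- The counit: the algebra homomorphism that sends each tree to `0`. -/
def counit : HCK K →ₐ[K] K :=
  MvPolynomial.aeval fun _ => 0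

/-- The natural growth operator: `N(F)` is the sum over the vertices `v` of the forest `F` of the
forests obtained by adding to `F` a new leaf with parent `v`. So it is the derivation
with `N(t) = ∑_v N_v(t)` for trees `t`. -/
def growth : Derivation K (HCK K) (HCK K) :=
  MvPolynomial.mkDerivation K fun t => (t.grafts.map (tree K)).sum

/-- The Connes–Moscovici generators `t₁ = •`, `t_{n+1} = N(t_n)` for `n ≥ 1`, together with
`t₀ = 1`. -/
def cmGen : ℕ → HCK K
  | 0 => 1
  | 1 => tree K RTree.bullet
  | n + 2 => growth K (cmGen (n + 1))

/-- The series `X = 1 + ∑_{n ≥ 1} t_n xⁿ` of the Connes–Moscovici generators. -/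
def cmSeries : PowerSeries (HCK K) := PowerSeries.mk (cmGen K)

variable {K}

/-- The coefficient of `T_j ⊗ T_i` (a tensor of two single variables) in an element of
`K[T₁, T₂, …] ⊗ K[T₁, T₂, …]`. -/
def coeffTensor (j i : ℕ+) : MvPolynomial ℕ+ K ⊗[K] MvPolynomial ℕ+ K →ₗ[K] K :=
  (TensorProduct.lid K K).toLinearMap ∘ₗ
    TensorProduct.map (MvPolynomial.lcoeff K (Finsupp.single j 1))
      (MvPolynomial.lcoeff K (Finsupp.single i 1))

/-- `t` generates a subbialgebra (each `Δ(t_n)` is a polynomial expression in the `t_k ⊗ 1` and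
`1 ⊗ t_k`) and `lam i j` is the coefficient of `t_j ⊗ t_i` in `Δ(t_n)`, `n = i + j`.
The expression of `Δ(t_n)` is unique if the `t_n` are algebraically independent. -/
def HasLambdaArray (t : ℕ+ → HCK K) (lam : ℕ+ → ℕ+ → K) : Prop :=
  ∀ n : ℕ+, ∃ P : MvPolynomial ℕ+ K ⊗[K] MvPolynomial ℕ+ K,
    Algebra.TensorProduct.map (MvPolynomial.aeval t) (MvPolynomial.aeval t) P = comul K (t n) ∧
      ∀ i j : ℕ+, i + j = n → coeffTensor j i P = lam i j

end HCK

/-! ### Feynman rules, Green functions, renormalization group equations -/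

/-- The coproduct of `K[L]`: the algebra homomorphism with `L ↦ L ⊗ 1 + 1 ⊗ L`. -/
def polyComul (K : Type*) [Field K] :
    Polynomial K →ₐ[K] Polynomial K ⊗[K] Polynomial K :=
  Polynomial.aeval (Polynomial.X ⊗ₜ[K] 1 + 1 ⊗ₜ[K] Polynomial.X)

/-- Feynman rules: Hopf algebra morphisms `H_CK → K[L]`, that is, algebra homomorphisms compatible
with the coproducts and the counits (the counit of `K[L]` is evaluation at `L = 0`);
compatibility with the antipodes is automatic. -/
structure FeynmanRules (K : Type*) [Field K] extends HCK K →ₐ[K] Polynomial K where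
  map_comul : ∀ a : HCK K,
    Algebra.TensorProduct.map toAlgHom toAlgHom (HCK.comul K a) = polyComul K (toAlgHom a)
  map_counit : ∀ a : HCK K, (toAlgHom a).eval 0 = HCK.counit K a

/-- The Green function `G(x, L) = φ(X(x))`, a power series in `x` over `K[L]`. -/
def greenFunction {K : Type*} [Field K] (φ : FeynmanRules K) (X : PowerSeries (HCK K)) :
    PowerSeries (Polynomial K) :=
  PowerSeries.map (φ.toAlgHom : HCK K →+* Polynomial K) X

/-- The derivative with respect to `L` of a power series in `x` over `K[L]`. -/
def partialL {K : Type*} [Field K] (G : PowerSeries (Polynomial K)) :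
    PowerSeries (Polynomial K) :=
  PowerSeries.mk fun n => Polynomial.derivative (PowerSeries.coeff n G)

/-- A power series in `x` alone, as a power series in `x` over `K[L]`. -/
def constL {K : Type*} [Field K] (b : PowerSeries K) : PowerSeries (Polynomial K) :=
  PowerSeries.map Polynomial.C b

/-- `(∂/∂L + β(x) ∂/∂x - γ(x)) G(x, L) = γ₀(x)`: the (first order) renormalization group equation
with inhomogeneity `γ₀`. The usual, homogeneous equation is the case `γ₀ = 0`. -/
def IsRGESolution {K : Type*} [Field K] (β γ γ₀ : PowerSeries K)
    (G : PowerSeries (Polynomial K)) : Prop :=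
  partialL G + constL β * PowerSeries.derivative (Polynomial K) G - constL γ * G = constL γ₀

end

/-! Write `N` for natural growth, `Y` for the vertex grading and `B` for grafting a forest to a new
root. The identities `Δ B = B ⊗ 1 + (id ⊗ B) Δ`, `N B(F) = B(t₁ F) + B(N F)` and `Y B = B Y + B`
give, by induction on trees, `Δ N = (N ⊗ id + id ⊗ N + (t₁ ⊗ 1)(id ⊗ Y)) Δ` (`comul_growth`). Since
`Y t_n = n t_n`, iteration yields `Δ(t_{m+1}) = t_{m+1} ⊗ 1 + ∑ P_{m,i} ⊗ t_{i+1}` with polynomials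
`P_{m,i}` in the generators (`comul_cmGen`). Modulo products of generators their recursion is
Pascal's rule, which gives the binomial coefficients (`leftPart_sub_mem`). Independence follows from
an algebra map sending `t_n` to a variable `T_n` (`sizeEval_cmGen`).

For Feynman rules, let `a m n` be the coefficient of `L^m` in `φ(t_n)`. Taking the coefficient of
`L` in the left tensor factor kills products, so for `m ≥ 1` one has `(m+1) a_{m+1,n} = ∑_{k+j=n}
C(n,j+1) a_{1,j} a_{m,k}`. If `p` is minimal with `a_{1,p} ≠ 0`, then `a m ·` starts exactly at `n =
mp`. In a renormalization group equation, comparing lowest orders for several `m` forces the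
coefficients of `β` up to order `p` and of `γ` below order `p` to vanish. At the next order
`C((m+1)p, p+1)` would have to be affine in `m`, contradicting strict convexity
(`choose_strictConvex`). -/

noncomputable section

/-! ### Vertices and grafting -/

namespace RTree

/-- The number of vertices of a tree. -/
def size : RTree → ℕ :=
  fold fun m => (m.map Prod.snd).sum + 1

theorem size_node (s : Multiset RTree) : size (node s) = (s.map size).sum + 1 := by
  rw [size, fold_node, Multiset.map_map]
  rfl

theorem size_pos (t : RTree) : 0 < size t := by
  induction t using RTree.induction with
  | h s _ => rw [size_node]; exact Nat.succ_pos _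

theorem size_bullet : size bullet = 1 := by
  simp [bullet, size_node]

/-- The number of vertices of a tree, as a positive integer. -/
def psize (t : RTree) : ℕ+ := ⟨size t, size_pos t⟩

theorem psize_bullet : psize bullet = 1 := PNat.eq size_bullet

/-- There is one graft per vertex; this count absorbs the factorials in `sizeEval_growth`. -/
theorem card_grafts (t : RTree) : (grafts t).card = size t := by
  induction t using RTree.induction with
  | h s ih =>
    rw [grafts_node, size_node, Multiset.card_cons, Multiset.card_bind]
    congr 2
    exact Multiset.map_congr rfl fun t ht => by simp [ih t ht]

theorem size_of_mem_grafts (t : RTree) : ∀ u ∈ grafts t, size u = size t + 1 := by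
  classical
  induction t using RTree.induction with
  | h s ih =>
    intro u hu
    rw [grafts_node, Multiset.mem_cons, Multiset.mem_bind] at hu
    rcases hu with rfl | ⟨t, ht, hu⟩
    · simp only [size_node, Multiset.map_cons, Multiset.sum_cons, size_bullet]
      omega
    · obtain ⟨v, hv, rfl⟩ := Multiset.mem_map.1 hu
      have h := congrArg (fun s => (s.map size).sum) (Multiset.cons_erase ht)
      have hv := ih t ht v hv
      simp only [Multiset.map_cons, Multiset.sum_cons] at h
      simp only [size_node, Multiset.map_cons, Multiset.sum_cons]
      convert congrArg (· + 2) h using 1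
      rw [hv]
      ring

end RTree

/-! ### Forests as a basis, grafting to a root, and the grading. -/

namespace HCK

variable (K : Type*) [Field K]

theorem forest_cons (t : RTree) (s : Multiset RTree) :
    forest K (t ::ₘ s) = tree K t * forest K s := by
  simp [forest]

theorem forest_zero : forest K 0 = 1 := by
  simp [forest]

theorem forest_singleton (t : RTree) : forest K {t} = tree K t := by
  simp [forest]

theorem forest_add (s u : Multiset RTree) : forest K (s + u) = forest K s * forest K u := by
  simp [forest]

theorem forest_toMultiset (m : RTree →₀ ℕ) :
    forest K (Finsupp.toMultiset m) = MvPolynomial.monomial m 1 := by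
  induction m using Finsupp.induction_linear with
  | zero => simp [forest_zero]
  | add f g hf hg => rw [map_add, forest_add, hf, hg, MvPolynomial.monomial_mul, one_mul]
  | single t n =>
    rw [Finsupp.toMultiset_single, forest, Multiset.map_nsmul, Multiset.prod_nsmul,
      Multiset.map_singleton, Multiset.prod_singleton, tree, MvPolynomial.X_pow_eq_monomial]

/-- Grafting all trees of a forest to a new root. -/
def graftRoot : HCK K →ₗ[K] HCK K :=
  (MvPolynomial.basisMonomials RTree K).constr K
    fun m => tree K (RTree.node (Finsupp.toMultiset m))

theorem graftRoot_forest (s : Multiset RTree) :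
    graftRoot K (forest K s) = tree K (RTree.node s) := by
  classical
  obtain ⟨m, rfl⟩ : ∃ m, Finsupp.toMultiset m = s :=
    ⟨Multiset.toFinsupp s, Multiset.toFinsupp_toMultiset s⟩
  rw [forest_toMultiset]
  exact (MvPolynomial.basisMonomials RTree K).constr_basis K _ m

variable {K} in
theorem linearMap_ext_forest {M : Type*} [AddCommMonoid M] [Module K M] {f g : HCK K →ₗ[K] M}
    (h : ∀ s, f (forest K s) = g (forest K s)) : f = g :=
  (MvPolynomial.basisMonomials RTree K).ext fun m => by
    simpa [← forest_toMultiset] using h (Finsupp.toMultiset m)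

theorem growth_tree (t : RTree) : growth K (tree K t) = (t.grafts.map (tree K)).sum := by
  simp [growth, tree]

open Classical in
theorem growth_forest (s : Multiset RTree) : growth K (forest K s) =
    (s.map fun t => growth K (tree K t) * forest K (s.erase t)).sum := by
  induction s using Multiset.induction with
  | empty => simp [forest_zero]
  | cons a s ih =>
    rw [forest_cons, Derivation.leibniz, ih, Multiset.map_cons, Multiset.sum_cons,
      Multiset.erase_cons_head, smul_eq_mul, smul_eq_mul, add_comm, mul_comm (forest K s),
      ← Multiset.sum_map_mul_left]
    congr 2
    refine Multiset.map_congr rfl fun t ht => ?_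
    by_cases hta : a = t
    · subst hta
      rw [Multiset.erase_cons_head, mul_left_comm, ← forest_cons, Multiset.cons_erase ht]
    · rw [Multiset.erase_cons_tail _ hta, forest_cons, mul_left_comm]

/-- Natural growth adds the new leaf either to the root or to the forest of the branches. -/
theorem growth_graftRoot (F : HCK K) : growth K (graftRoot K F) =
    graftRoot K (tree K RTree.bullet * F) + graftRoot K (growth K F) := by
  classical
  suffices h : (growth K).toLinearMap ∘ₗ graftRoot K =
      graftRoot K ∘ₗ LinearMap.mulLeft K (tree K RTree.bullet) +
        graftRoot K ∘ₗ (growth K).toLinearMap from LinearMap.congr_fun h F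
  refine linearMap_ext_forest fun s => ?_
  simp only [LinearMap.comp_apply, LinearMap.add_apply, Derivation.coeFn_coe,
    LinearMap.mulLeft_apply]
  rw [← forest_cons, graftRoot_forest, graftRoot_forest, growth_tree, RTree.grafts_node,
    Multiset.map_cons, Multiset.sum_cons, growth_forest, map_multiset_sum, Multiset.map_map,
    Multiset.map_bind, Multiset.sum_bind]
  congr 2
  refine Multiset.map_congr rfl fun t _ => ?_
  rw [Function.comp_apply, growth_tree, ← Multiset.sum_map_mul_right, map_multiset_sum,
    Multiset.map_map, Multiset.map_map]
  congr 1
  refine Multiset.map_congr rfl fun u _ => ?_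
  simp only [Function.comp_apply]
  rw [← forest_cons, graftRoot_forest]

/-- The derivation multiplying each tree by its number of vertices. -/
def grading : Derivation K (HCK K) (HCK K) :=
  MvPolynomial.mkDerivation K fun t => (t.size : K) • tree K t

theorem grading_tree (t : RTree) : grading K (tree K t) = (t.size : K) • tree K t := by
  simp [grading, tree]

theorem grading_forest (s : Multiset RTree) :
    grading K (forest K s) = ((s.map RTree.size).sum : K) • forest K s := by
  induction s using Multiset.induction with
  | empty => simp [forest_zero]
  | cons a s ih =>
    rw [forest_cons, Derivation.leibniz, ih, grading_tree]
    simp only [smul_eq_mul, Multiset.map_cons, Multiset.sum_cons, Nat.cast_add, add_smul,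
      mul_smul_comm, mul_comm (forest K s), smul_mul_assoc]
    rw [add_comm]

theorem grading_graftRoot (F : HCK K) :
    grading K (graftRoot K F) = graftRoot K (grading K F) + graftRoot K F := by
  suffices h : (grading K).toLinearMap ∘ₗ graftRoot K =
      graftRoot K ∘ₗ (grading K).toLinearMap + graftRoot K from LinearMap.congr_fun h F
  refine linearMap_ext_forest fun s => ?_
  simp [graftRoot_forest, grading_tree, grading_forest, RTree.size_node, add_smul]

/-! ### The coproduct and natural growth -/

theorem comul_tree (t : RTree) : comul K (tree K t) = tree K t ⊗ₜ[K] 1 +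
    (t.cuts.map fun c => forest K c.1 ⊗ₜ[K] tree K c.2).sum := by
  simp [comul, tree]

/-- Cutting the edge above the branch supplies the term `t ⊗ 1` missing from the sum over cuts of
`t`. -/
theorem sum_branchCuts (t : RTree) :
    ((RTree.branchCuts (t, t.cuts)).map fun c => forest K c.1 ⊗ₜ[K] forest K c.2).sum =
      comul K (tree K t) := by
  simp [RTree.branchCuts, comul_tree, forest_singleton, forest_zero, Multiset.map_map]

theorem comul_forest (s : Multiset RTree) :
    comul K (forest K s) = (s.map fun t => comul K (tree K t)).prod := by
  rw [forest, map_multiset_prod, Multiset.map_map]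
  rfl

/-- A cut is an independent choice for each branch, so expanding the product of the branch
coproducts enumerates the cuts; `graftRoot` then reattaches what remains to the root. -/
theorem sum_cuts_node (s : Multiset RTree) :
    (((RTree.node s).cuts).map fun c => forest K c.1 ⊗ₜ[K] tree K c.2).sum =
      TensorProduct.map LinearMap.id (graftRoot K) (comul K (forest K s)) := by
  have h : comul K (forest K s) =
      (((s.map fun t => RTree.branchCuts (t, t.cuts)).Sections).map
        fun c => forest K c.sum.1 ⊗ₜ[K] forest K c.sum.2).sum := by
    rw [comul_forest]
    simp only [← sum_branchCuts]
    have hs : ∀ m : Multiset (Multiset (Multiset RTree × Multiset RTree)),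
        (m.map fun b => (b.map fun c => forest K c.1 ⊗ₜ[K] forest K c.2).sum).prod =
          (m.Sections.map fun c => forest K c.sum.1 ⊗ₜ[K] forest K c.sum.2).sum := by
      intro m
      induction m using Multiset.induction with
      | empty => simp [forest_zero, Algebra.TensorProduct.one_def]
      | cons b m ih =>
        simp [ih, Multiset.map_bind, Multiset.sum_bind, Multiset.map_map,
          ← Multiset.sum_map_mul_left, ← Multiset.sum_map_mul_right, forest_add]
        exact Multiset.sum_map_sum_map _ _
    simpa [Multiset.map_map] using hs (s.map fun t => RTree.branchCuts (t, t.cuts))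
  rw [h, RTree.cuts_node, map_multiset_sum, Multiset.map_map, Multiset.map_map]
  congr 1
  refine Multiset.map_congr rfl fun c _ => ?_
  simp [graftRoot_forest]

/-- Grafting to a new root is a cocycle. -/
theorem comul_graftRoot (F : HCK K) : comul K (graftRoot K F) =
    graftRoot K F ⊗ₜ[K] 1 + TensorProduct.map LinearMap.id (graftRoot K) (comul K F) := by
  suffices h : (comul K).toLinearMap ∘ₗ graftRoot K =
      (TensorProduct.mk K (HCK K) (HCK K)).flip 1 ∘ₗ graftRoot K +
        TensorProduct.map LinearMap.id (graftRoot K) ∘ₗ (comul K).toLinearMap from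
    LinearMap.congr_fun h F
  refine linearMap_ext_forest fun s => ?_
  simp [graftRoot_forest, comul_tree, sum_cuts_node]

/-- The operator `N ⊗ id + id ⊗ N + (t₁ ⊗ 1) (id ⊗ Y)` on `H_CK ⊗ H_CK`, where `N` is natural
growth and `Y` the grading. -/
def growthTensor : HCK K ⊗[K] HCK K →ₗ[K] HCK K ⊗[K] HCK K :=
  TensorProduct.map (growth K).toLinearMap LinearMap.id +
    TensorProduct.map LinearMap.id (growth K).toLinearMap +
    TensorProduct.map (LinearMap.mulLeft K (tree K RTree.bullet)) (grading K).toLinearMap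

theorem growthTensor_tmul (a b : HCK K) : growthTensor K (a ⊗ₜ b) =
    growth K a ⊗ₜ b + a ⊗ₜ growth K b + (tree K RTree.bullet * a) ⊗ₜ grading K b := by
  simp [growthTensor]

/-- Each of the three summands is a derivation of the tensor product, the last being the derivation
`id ⊗ Y` multiplied by `t₁ ⊗ 1`. -/
theorem growthTensor_mul (x y : HCK K ⊗[K] HCK K) :
    growthTensor K (x * y) = x * growthTensor K y + y * growthTensor K x := by
  induction x using TensorProduct.induction_on with
  | zero => simp
  | add x₁ x₂ h₁ h₂ => rw [add_mul, map_add, h₁, h₂, map_add]; ring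
  | tmul a b =>
    induction y using TensorProduct.induction_on with
    | zero => simp
    | add y₁ y₂ h₁ h₂ => rw [mul_add, map_add, h₁, h₂, map_add]; ring
    | tmul c d =>
      simp only [Algebra.TensorProduct.tmul_mul_tmul, growthTensor_tmul, Derivation.leibniz,
        smul_eq_mul, TensorProduct.tmul_add, TensorProduct.add_tmul, mul_add]
      rw [mul_comm d b, mul_comm c a, mul_left_comm a, mul_left_comm c, mul_comm c a]
      abel

theorem comul_bullet : comul K (tree K RTree.bullet) =
    tree K RTree.bullet ⊗ₜ 1 + 1 ⊗ₜ tree K RTree.bullet := by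
  have h := comul_graftRoot K (forest K 0)
  rw [graftRoot_forest, forest_zero, map_one, Algebra.TensorProduct.one_def,
    TensorProduct.map_tmul, ← forest_zero, graftRoot_forest, forest_zero] at h
  exact h

/-- Commuting `N` past `B` leaves `1 ⊗ t₁`, commuting `Y` past `B` leaves `t₁ ⊗ 1`; together they
form `Δ(t₁)`. -/
theorem growthTensor_map_graftRoot (x : HCK K ⊗[K] HCK K) :
    growthTensor K (TensorProduct.map LinearMap.id (graftRoot K) x) =
      TensorProduct.map LinearMap.id (graftRoot K)
        (comul K (tree K RTree.bullet) * x + growthTensor K x) := by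
  induction x using TensorProduct.induction_on with
  | zero => simp
  | add x₁ x₂ h₁ h₂ => simp only [map_add, mul_add, h₁, h₂]; abel
  | tmul a b =>
    simp only [comul_bullet, growthTensor_tmul, TensorProduct.map_tmul, LinearMap.id_apply,
      growth_graftRoot, grading_graftRoot, TensorProduct.tmul_add, map_add, add_mul,
      Algebra.TensorProduct.tmul_mul_tmul, one_mul]
    abel

/-- Assuming the identity only for the trees of `s` lets this serve as the inductive step for the
tree with branches `s`. -/
theorem comul_growth_forest {s : Multiset RTree}
    (h : ∀ t ∈ s, comul K (growth K (tree K t)) = growthTensor K (comul K (tree K t))) :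
    comul K (growth K (forest K s)) = growthTensor K (comul K (forest K s)) := by
  induction s using Multiset.induction with
  | empty => simp [forest_zero, Algebra.TensorProduct.one_def, growthTensor_tmul]
  | cons a s ih =>
    rw [Multiset.forall_mem_cons] at h
    rw [forest_cons, Derivation.leibniz, map_mul, growthTensor_mul, ← h.1, ← ih h.2]
    simp

/-- The coproduct intertwines natural growth with `growthTensor`. -/
theorem comul_growth_tree (t : RTree) :
    comul K (growth K (tree K t)) = growthTensor K (comul K (tree K t)) := by
  induction t using RTree.induction with
  | h s ih =>
    rw [← graftRoot_forest, growth_graftRoot, map_add, comul_graftRoot, comul_graftRoot,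
      comul_graftRoot, map_mul (comul K), comul_growth_forest K ih, map_add, growthTensor_map_graftRoot,
      growthTensor_tmul, growth_graftRoot, map_add, TensorProduct.add_tmul]
    simp only [Derivation.map_one_eq_zero, TensorProduct.tmul_zero, add_zero]
    abel

theorem comul_growth (a : HCK K) :
    comul K (growth K a) = growthTensor K (comul K a) := by
  suffices h : (comul K).toLinearMap ∘ₗ (growth K).toLinearMap =
      growthTensor K ∘ₗ (comul K).toLinearMap from LinearMap.congr_fun h a
  exact linearMap_ext_forest fun s => comul_growth_forest K fun t _ => comul_growth_tree K t

end HCK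

/-! ### An abstract obstruction to first-order renormalization group equations -/

namespace RGEObstruction

open Finset.HasAntidiagonal (antidiagonal mem_antidiagonal)

theorem choose_strictConvex {p : ℕ} (hp : 1 ≤ p) :
    2 * (3 * p).choose (p + 1) < (4 * p).choose (p + 1) + (2 * p).choose (p + 1) := by
  -- By Pascal's rule the gap grows by at least one with each increment of `r`; at `r = p ≥ 1` this
  -- gives strictness.
  have step : ∀ r, (2 * p + r).choose (p + 1) + (3 * p).choose (p + 1) + r ≤
      (3 * p + r).choose (p + 1) + (2 * p).choose (p + 1) := by
    intro r
    induction r with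
    | zero => simp [add_comm]
    | succ r ih =>
      rw [← add_assoc, ← add_assoc, ← add_assoc, Nat.choose_succ_succ',
        Nat.choose_succ_succ' (3 * p + r)]
      have h : (2 * p + r).choose p < (3 * p + r).choose p := by
        obtain ⟨q, rfl⟩ : ∃ q, p = q + 1 := ⟨p - 1, by omega⟩
        have h1 : (2 * (q + 1) + r).choose (q + 1) < (2 * (q + 1) + r + 1).choose (q + 1) := by
          rw [Nat.choose_succ_succ']
          have := Nat.choose_pos (show q ≤ 2 * (q + 1) + r by omega)
          omega
        exact h1.trans_le (Nat.choose_le_choose _ (by omega))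
      omega
  have := step p
  rw [show 2 * p + p = 3 * p by ring, show 3 * p + p = 4 * p by ring] at this
  omega

variable {K : Type*} [Field K] [CharZero K]

section Array

variable {a : ℕ → ℕ → K} {p : ℕ}

/-- If `k + j < (m + 1) p`, then `j < p` or `k < m p`, so every term of the recursion vanishes. -/
theorem coeff_eq_zero (hp : ∀ j < p, a 1 j = 0)
    (hrec : ∀ m n : ℕ, 1 ≤ m → ((m : K) + 1) * a (m + 1) n =
      ∑ x ∈ antidiagonal n, (n.choose (x.2 + 1) : K) * a 1 x.2 * a m x.1)
    {m : ℕ} (hm : 1 ≤ m) : ∀ i < m * p, a m i = 0 := by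
  induction m, hm using Nat.le_induction with
  | base => simpa using hp
  | succ m hm ih =>
    intro i hi
    have h := hrec m i hm
    rw [Finset.sum_eq_zero, mul_eq_zero] at h
    · exact h.resolve_left (Nat.cast_add_one_ne_zero _)
    · rintro ⟨k, j⟩ hx
      rw [mem_antidiagonal] at hx
      dsimp only at hx ⊢
      rw [add_mul, one_mul] at hi
      by_cases hj : j < p
      · simp [hp j hj]
      · simp [ih k (by omega)]

/-- At `n = (m + 1) p` only the term `k = m p`, `j = p` survives. -/
theorem coeff_diagonal (hp : ∀ j < p, a 1 j = 0)
    (hrec : ∀ m n : ℕ, 1 ≤ m → ((m : K) + 1) * a (m + 1) n =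
      ∑ x ∈ antidiagonal n, (n.choose (x.2 + 1) : K) * a 1 x.2 * a m x.1)
    {m : ℕ} (hm : 1 ≤ m) : ((m : K) + 1) * a (m + 1) (m * p + p) =
      ((m * p + p).choose (p + 1) : K) * a 1 p * a m (m * p) := by
  rw [hrec m _ hm, Finset.sum_eq_single (m * p, p)]
  · rintro ⟨k, j⟩ hx hne
    rw [mem_antidiagonal] at hx
    dsimp only at hx ⊢
    rcases lt_trichotomy j p with hj | rfl | hj
    · simp [hp j hj]
    · exact absurd (by simpa using hx) hne
    · simp [coeff_eq_zero hp hrec hm k (by omega)]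
  · simp

theorem coeff_diagonal_ne_zero (hp1 : 1 ≤ p) (hp : ∀ j < p, a 1 j = 0) (hp0 : a 1 p ≠ 0)
    (hrec : ∀ m n : ℕ, 1 ≤ m → ((m : K) + 1) * a (m + 1) n =
      ∑ x ∈ antidiagonal n, (n.choose (x.2 + 1) : K) * a 1 x.2 * a m x.1)
    {m : ℕ} (hm : 1 ≤ m) : a m (m * p) ≠ 0 := by
  induction m, hm using Nat.le_induction with
  | base => simpa using hp0
  | succ m hm ih =>
    have h := coeff_diagonal hp hrec hm
    have hc : ((m * p + p).choose (p + 1) : K) ≠ 0 := by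
      have h1 : p ≤ m * p := Nat.le_mul_of_pos_left p hm
      exact_mod_cast (Nat.choose_pos (by omega)).ne'
    rw [add_mul, one_mul]
    intro h0
    rw [h0, mul_zero] at h
    exact mul_ne_zero (mul_ne_zero hc hp0) ih h.symm

omit [CharZero K] in
/-- The lowest-order instance of a renormalization group equation when the lower coefficients of
`β` and `γ` vanish. -/
theorem rge_lowest {b g : ℕ → K} {r m : ℕ} (hm : 1 ≤ m) (hp1 : 1 ≤ p)
    (hz : ∀ i < m * p, a m i = 0)
    (hrge : ∀ n, ((m : K) + 1) * a (m + 1) n +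
      ∑ x ∈ antidiagonal n, b x.1 * (a m (x.2 + 1) * ((x.2 : K) + 1)) -
      ∑ x ∈ antidiagonal n, g x.1 * a m x.2 = 0)
    (hb : ∀ k ≤ r, b k = 0) (hg : ∀ k < r, g k = 0) :
    ((m : K) + 1) * a (m + 1) (m * p + r) + (b (r + 1) * (m * p : ℕ) - g r) * a m (m * p) = 0 := by
  have hmp : 1 ≤ m * p := Nat.mul_pos hm hp1
  have h := hrge (m * p + r)
  -- The derivative in `x` shifts the index, so the leading coefficient `a m (m * p)` sits at `m * p
  -- - 1` in the `β` sum.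
  rw [Finset.sum_eq_single (r + 1, m * p - 1), Finset.sum_eq_single (r, m * p)] at h
  · dsimp only at h
    rw [Nat.sub_add_cancel hmp, Nat.cast_sub hmp] at h
    rw [← h]
    push_cast
    ring
  · rintro ⟨k, i⟩ hx hne
    rw [mem_antidiagonal] at hx
    dsimp only at hx ⊢
    rcases lt_trichotomy k r with hk | rfl | hk
    · simp [hg k hk]
    · exact absurd (by ext <;> simp; omega) hne
    · simp [hz i (by omega)]
  · intro h1
    exact absurd (by simp [add_comm]) h1
  · rintro ⟨k, i⟩ hx hne
    rw [mem_antidiagonal] at hx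
    dsimp only at hx ⊢
    rcases lt_trichotomy k (r + 1) with hk | rfl | hk
    · simp [hb k (by omega)]
    · exact absurd (by ext <;> simp; omega) hne
    · simp [hz (i + 1) (by omega)]
  · intro h1
    exact absurd (by rw [mem_antidiagonal]; dsimp only; omega) h1

/-- An array satisfying the recursion of the Connes–Moscovici generators under Feynman rules does
not satisfy a first-order renormalization group equation. -/
theorem no_rge (h0 : a 1 0 = 0) (hne : ∃ j, a 1 j ≠ 0)
    (hrec : ∀ m n : ℕ, 1 ≤ m → ((m : K) + 1) * a (m + 1) n =
      ∑ x ∈ antidiagonal n, (n.choose (x.2 + 1) : K) * a 1 x.2 * a m x.1)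
    (b g : ℕ → K) (hrge : ∀ m n : ℕ, 1 ≤ m → ((m : K) + 1) * a (m + 1) n +
      ∑ x ∈ antidiagonal n, b x.1 * (a m (x.2 + 1) * ((x.2 : K) + 1)) -
      ∑ x ∈ antidiagonal n, g x.1 * a m x.2 = 0) : False := by
  classical
  obtain ⟨p, hp0, hp⟩ : ∃ p, a 1 p ≠ 0 ∧ ∀ j < p, a 1 j = 0 :=
    ⟨Nat.find hne, Nat.find_spec hne, fun j hj => not_not.1 (Nat.find_min hne hj)⟩
  have hp1 : 1 ≤ p := Nat.one_le_iff_ne_zero.2 fun h => hp0 (h ▸ h0)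
  have hz := fun m (hm : 1 ≤ m) => coeff_eq_zero hp hrec hm
  have hd := fun m (hm : 1 ≤ m) => coeff_diagonal_ne_zero hp1 hp hp0 hrec hm
  have hpK : (p : K) ≠ 0 := by exact_mod_cast (by omega : p ≠ 0)
  -- At `m = 1`, `n = p - 1` only `b 0 * a 1 p * p` remains.
  have hb0 : b 0 = 0 := by
    have h := hrge 1 (p - 1) le_rfl
    rw [hz 2 (by norm_num) _ (by omega), Finset.sum_eq_single (0, p - 1), Finset.sum_eq_zero] at h
    · dsimp only at h
      rw [Nat.sub_add_cancel hp1, Nat.cast_sub hp1] at h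
      simpa [hp0, hpK] using h
    · rintro ⟨k, i⟩ hx
      rw [mem_antidiagonal] at hx
      dsimp only at hx ⊢
      rw [hp i (by omega), mul_zero]
    · rintro ⟨k, i⟩ hx hne
      rw [mem_antidiagonal] at hx
      dsimp only at hx ⊢
      have hk : k ≠ 0 := by
        rintro rfl
        exact hne (by ext <;> simp; omega)
      rw [hp (i + 1) (by omega), zero_mul, mul_zero]
    · intro h1
      exact absurd (by rw [mem_antidiagonal]; dsimp only; omega) h1
  have hlow : ∀ r ≤ p, (∀ k ≤ r, b k = 0) ∧ ∀ k < r, g k = 0 := by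
    intro r
    induction r with
    | zero => exact fun _ => ⟨fun k hk => by rwa [Nat.le_zero.1 hk], by simp⟩
    | succ r ih =>
      intro hr
      obtain ⟨hb, hg⟩ := ih (by omega)
      -- Here `r < p`, so `m * p + r` lies below the support of `a (m + 1)`. The values `m = 1, 2`
      -- of this affine function of `m` then kill both unknowns.
      have key : ∀ m, 1 ≤ m → b (r + 1) * (m * p : ℕ) - g r = 0 := by
        intro m hm
        have h := rge_lowest hm hp1 (hz m hm) (fun n => hrge m n hm) hb hg
        rw [hz (m + 1) (by omega) _ (by rw [add_mul]; omega), mul_zero, zero_add,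
          mul_eq_zero] at h
        exact h.resolve_right (hd m hm)
      have h1 := key 1 le_rfl
      have h2 := key 2 (by norm_num)
      push_cast at h1 h2
      have hb' : b (r + 1) = 0 := by
        have : b (r + 1) * p = 0 := by linear_combination h2 - h1
        exact (mul_eq_zero.1 this).resolve_right hpK
      have hg' : g r = 0 := by simpa [hb'] using h1
      refine ⟨fun k hk => ?_, fun k hk => ?_⟩
      · rcases Nat.le_succ_iff.1 hk with hk | rfl
        exacts [hb k hk, hb']
      · rcases Nat.lt_succ_iff_lt_or_eq.1 hk with hk | rfl
        exacts [hg k hk, hg']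
  obtain ⟨hb, hg⟩ := hlow p le_rfl
  -- At `r = p` the term from `a (m + 1)` is its leading one and contributes the binomial.
  have key : ∀ m, 1 ≤ m → ((m * p + p).choose (p + 1) : K) * a 1 p +
      b (p + 1) * (m * p : ℕ) - g p = 0 := by
    intro m hm
    have h := rge_lowest hm hp1 (hz m hm) (fun n => hrge m n hm) hb hg
    rw [coeff_diagonal hp hrec hm] at h
    refine (mul_eq_zero.1 (?_ : _ * a m (m * p) = 0)).resolve_right (hd m hm)
    linear_combination h
  have h1 := key 1 le_rfl
  have h2 := key 2 (by norm_num)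
  have h3 := key 3 (by norm_num)
  rw [show 1 * p + p = 2 * p by ring] at h1
  rw [show 2 * p + p = 3 * p by ring] at h2
  rw [show 3 * p + p = 4 * p by ring] at h3
  push_cast at h1 h2 h3
  -- The second difference in `m` eliminates `b (p + 1)` and `g p`.
  have h4 : ((4 * p).choose (p + 1) + (2 * p).choose (p + 1) -
      2 * (3 * p).choose (p + 1) : K) * a 1 p = 0 := by
    linear_combination h3 + h1 - 2 * h2
  have h5 := (mul_eq_zero.1 h4).resolve_right hp0
  rw [sub_eq_zero] at h5
  exact (choose_strictConvex hp1).ne' (by exact_mod_cast h5)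

end Array

/-- Polynomials `f n` whose `L`-derivatives satisfy the recursion of the Connes–Moscovici
generators: a power series with these coefficients solves no renormalization group equation. -/
theorem no_rge_polynomial {f : ℕ → Polynomial K} (f0 : f 0 = 1)
    (hf : ∀ n, 1 ≤ n → (f n).coeff 0 = 0) (hne : ∃ n, 1 ≤ n ∧ f n ≠ 0)
    (hder : ∀ n, Polynomial.derivative (f n) = Polynomial.C ((f n).coeff 1) +
      ∑ x ∈ antidiagonal n,
        Polynomial.C ((n.choose (x.2 + 1) : K) * (f x.2).coeff 1) * f x.1)
    (β γ γ₀ : PowerSeries K) : ¬ IsRGESolution β γ γ₀ (PowerSeries.mk f) := by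
  intro hrge
  have hrec : ∀ m n : ℕ, 1 ≤ m → ((m : K) + 1) * (f n).coeff (m + 1) =
      ∑ x ∈ antidiagonal n, (n.choose (x.2 + 1) : K) * (f x.2).coeff 1 *
        (f x.1).coeff m := by
    intro m n hm
    have h := congrArg (Polynomial.coeff · m) (hder n)
    simp only [Polynomial.coeff_derivative, Polynomial.coeff_add, Polynomial.finsetSum_coeff,
      Polynomial.coeff_C_mul, Polynomial.coeff_C_of_ne_zero (by omega : m ≠ 0), zero_add] at h
    rw [← h, mul_comm]
  refine no_rge (a := fun m n => (f n).coeff m) (by simp [f0, Polynomial.coeff_one]) ?_ hrec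
    (fun k => PowerSeries.coeff k β) (fun k => PowerSeries.coeff k γ) ?_
  -- If all linear coefficients vanish, the recursion kills the higher ones as well.
  · by_contra! hall
    obtain ⟨n, hn, hfn⟩ := hne
    refine hfn (Polynomial.ext fun m => ?_)
    rw [Polynomial.coeff_zero]
    match m with
    | 0 => exact hf n hn
    | 1 => exact hall n
    | m + 2 =>
      have h := hrec (m + 1) n (by omega)
      rw [Finset.sum_eq_zero fun x _ => by rw [hall]; ring, mul_eq_zero] at h
      exact h.resolve_left (Nat.cast_add_one_ne_zero _)
  -- The inhomogeneity is constant in `L`, so it drops out of every coefficient with `m ≥ 1`.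
  · intro m n hm
    have h := congrArg (fun G => (PowerSeries.coeff n G).coeff m) hrge
    simp only [partialL, constL, map_sub, map_add, PowerSeries.coeff_mk, PowerSeries.coeff_mul,
      PowerSeries.coeff_map, PowerSeries.coeff_derivative, Polynomial.coeff_sub,
      Polynomial.coeff_add, Polynomial.finsetSum_coeff, Polynomial.coeff_C_mul,
      Polynomial.coeff_derivative, Polynomial.coeff_C_of_ne_zero (by omega : m ≠ 0)] at h
    rw [← h, mul_comm]
    congr 2
    refine Finset.sum_congr rfl fun x _ => ?_
    congr 1
    rw [← Nat.cast_succ, ← Nat.cast_succ, Polynomial.coeff_mul_natCast]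

end RGEObstruction

/-! ### The Connes–Moscovici generators -/

namespace HCK

variable (K : Type*) [Field K]

theorem cmGen_succ_succ (n : ℕ) : cmGen K (n + 2) = growth K (cmGen K (n + 1)) := rfl

/-- Both sides are derivations along `f`, so agreement on trees suffices. Used with `d = 0` for the
counit and with `shift` for `sizeEval`. -/
theorem algHom_growth {A : Type*} [CommRing A] [Algebra K A] (f : HCK K →ₐ[K] A)
    (d : Derivation K A A) (h : ∀ t, f (growth K (tree K t)) = d (f (tree K t))) (a : HCK K) :
    f (growth K a) = d (f a) := by
  induction a using MvPolynomial.induction_on with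
  | C r => rw [MvPolynomial.derivation_C, ← MvPolynomial.algebraMap_eq]; simp
  | add p q hp hq => simp only [map_add, hp, hq]
  | mul_X p t hp =>
    have ht := h t
    rw [tree] at ht
    simp only [Derivation.leibniz, map_add, smul_eq_mul, map_mul, hp, ht]

theorem counit_growth (a : HCK K) : counit K (growth K a) = 0 := by
  refine algHom_growth K (counit K) 0 (fun t => ?_) a
  rw [growth_tree, map_multiset_sum, Multiset.map_map]
  simp [counit, tree]

theorem counit_cmGen (n : ℕ) : counit K (cmGen K (n + 1)) = 0 := by
  cases n with
  | zero => simp [cmGen, counit, tree]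
  | succ n => rw [cmGen_succ_succ, counit_growth]

theorem grading_growth (a : HCK K) :
    grading K (growth K a) = growth K (grading K a) + growth K a := by
  suffices h : ⁅grading K, growth K⁆ = growth K by
    have := congrArg (· a) h
    simp only [Derivation.commutator_apply] at this
    rw [add_comm]
    exact sub_eq_iff_eq_add.1 this
  refine MvPolynomial.derivation_ext fun t => ?_
  have hg : grading K (growth K (tree K t)) = ((t.size : K) + 1) • growth K (tree K t) := by
    rw [growth_tree, map_multiset_sum, Multiset.map_map, Multiset.smul_sum, Multiset.map_map]
    congr 1
    refine Multiset.map_congr rfl fun u hu => ?_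
    simp [grading_tree, RTree.size_of_mem_grafts t u hu]
  change ⁅grading K, growth K⁆ (tree K t) = growth K (tree K t)
  rw [Derivation.commutator_apply, hg, grading_tree, Derivation.map_smul, add_smul, one_smul]
  abel

theorem grading_cmGen (n : ℕ) :
    grading K (cmGen K (n + 1)) = ((n : K) + 1) • cmGen K (n + 1) := by
  induction n with
  | zero => simp [cmGen, grading_tree, RTree.size_bullet]
  | succ n ih =>
    rw [cmGen_succ_succ, grading_growth, ih, Derivation.map_smul, ← cmGen_succ_succ]
    push_cast
    simp only [add_smul, one_smul]

/-! ### Algebraic independence by counting vertices. -/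

/-- Natural growth on `K[T₁, T₂, …]`: the derivation with `T_k ↦ T_{k+1}`. -/
def shift : Derivation K (MvPolynomial ℕ+ K) (MvPolynomial ℕ+ K) :=
  MvPolynomial.mkDerivation K fun k => MvPolynomial.X (k + 1)

theorem shift_X (k : ℕ+) : shift K (MvPolynomial.X k) = MvPolynomial.X (k + 1) := by
  simp [shift]

/-- Sends each tree `t` with `n` vertices to `T_n / (n - 1)!`. -/
def sizeEval : HCK K →ₐ[K] MvPolynomial ℕ+ K :=
  MvPolynomial.aeval fun t =>
    (((t.size - 1).factorial : K)⁻¹) • MvPolynomial.X t.psize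

theorem sizeEval_tree (t : RTree) : sizeEval K (tree K t) =
    (((t.size - 1).factorial : K)⁻¹) • MvPolynomial.X t.psize := by
  simp [sizeEval, tree]

/-- A tree with `n` vertices has `n` grafts, each sent to `T_{n+1} / n!`; their sum is `T_{n+1} / (n
- 1)!`. -/
theorem sizeEval_growth [CharZero K] (a : HCK K) :
    sizeEval K (growth K a) = shift K (sizeEval K a) := by
  refine algHom_growth K _ _ (fun t => ?_) a
  have h : ∀ u ∈ t.grafts, sizeEval K (tree K u) =
      ((t.size.factorial : K)⁻¹) • MvPolynomial.X (t.psize + 1) := by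
    intro u hu
    have hs := RTree.size_of_mem_grafts t u hu
    rw [sizeEval_tree]
    congr 2
    · rw [hs, Nat.add_sub_cancel]
    · exact PNat.eq hs
  rw [growth_tree, map_multiset_sum, Multiset.map_map, Multiset.map_congr rfl (show ∀ u ∈ t.grafts,
      (sizeEval K ∘ tree K) u = _ from h),
    Multiset.map_const', Multiset.sum_replicate, RTree.card_grafts, sizeEval_tree, Derivation.map_smul,
    shift_X, ← Nat.cast_smul_eq_nsmul K, smul_smul]
  congr 1
  obtain ⟨n, hn⟩ : ∃ n, t.size = n + 1 := ⟨t.size - 1, by have := t.size_pos; omega⟩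
  rw [hn, Nat.add_sub_cancel, Nat.factorial_succ]
  have h1 : ((n + 1 : ℕ) : K) ≠ 0 := Nat.cast_ne_zero.2 n.succ_ne_zero
  rw [Nat.cast_mul, mul_inv, ← mul_assoc, mul_inv_cancel₀ h1, one_mul]

theorem sizeEval_cmGen [CharZero K] (n : ℕ) :
    sizeEval K (cmGen K (n + 1)) = MvPolynomial.X n.succPNat := by
  induction n with
  | zero =>
    rw [zero_add, cmGen, sizeEval_tree, RTree.psize_bullet, RTree.size_bullet]
    simp only [Nat.sub_self, Nat.factorial_zero, Nat.cast_one, inv_one, one_smul]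
    rfl
  | succ n ih =>
    rw [cmGen_succ_succ, sizeEval_growth, ih, shift_X]
    rfl

theorem algebraicIndependent_cmGen [CharZero K] :
    AlgebraicIndependent K (fun n : ℕ+ => cmGen K n) := by
  refine AlgebraicIndependent.of_comp (sizeEval K) ?_
  convert MvPolynomial.algebraicIndependent_X ℕ+ K using 1
  funext n
  obtain ⟨m, rfl⟩ : ∃ m : ℕ, n = m.succPNat := ⟨n.natPred, (PNat.succPNat_natPred n).symm⟩
  exact sizeEval_cmGen K m

/-! ### The coproduct of the generators and its linear part. -/

/-- The algebra homomorphism `T_n ↦ t_n`. -/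
def aevalCM : MvPolynomial ℕ+ K →ₐ[K] HCK K :=
  MvPolynomial.aeval fun n : ℕ+ => cmGen K n

theorem aevalCM_X (n : ℕ) : aevalCM K (MvPolynomial.X n.succPNat) = cmGen K (n + 1) := by
  simp [aevalCM]

theorem aevalCM_X_one : aevalCM K (MvPolynomial.X 1) = tree K RTree.bullet := aevalCM_X K 0

theorem aevalCM_shift (b : MvPolynomial ℕ+ K) :
    aevalCM K (shift K b) = growth K (aevalCM K b) := by
  induction b using MvPolynomial.induction_on with
  | C r => rw [MvPolynomial.derivation_C, ← MvPolynomial.algebraMap_eq]; simp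
  | add p q hp hq => simp only [map_add, hp, hq]
  | mul_X p n hp =>
    obtain ⟨m, rfl⟩ : ∃ m : ℕ, n = m.succPNat := ⟨n.natPred, (PNat.succPNat_natPred n).symm⟩
    have h : aevalCM K (MvPolynomial.X (m.succPNat + 1)) = cmGen K (m + 2) :=
      aevalCM_X K (m + 1)
    simp only [Derivation.leibniz, map_add, smul_eq_mul, map_mul, hp, shift_X, aevalCM_X, h,
      cmGen_succ_succ]

/-- `leftPart m i` is the factor of `t_{i+1}` in `Δ(t_{m+1})`, see `comul_cmGen`. -/
def leftPart : ℕ → ℕ → MvPolynomial ℕ+ K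
  | 0, 0 => 1
  | 0, _ + 1 => 0
  | m + 1, 0 => shift K (leftPart m 0) + MvPolynomial.X 1 * leftPart m 0
  | m + 1, i + 1 => shift K (leftPart m (i + 1)) + leftPart m i +
      ((i : K) + 2) • (MvPolynomial.X 1 * leftPart m (i + 1))

theorem leftPart_eq_zero {m i : ℕ} (h : m < i) : leftPart K m i = 0 := by
  induction m generalizing i with
  | zero =>
    obtain ⟨i, rfl⟩ : ∃ j, i = j + 1 := ⟨i - 1, by omega⟩
    rfl
  | succ m ih =>
    obtain ⟨i, rfl⟩ : ∃ j, i = j + 1 := ⟨i - 1, by omega⟩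
    rw [leftPart, ih (by omega), ih (by omega)]
    simp

theorem leftPart_self (m : ℕ) : leftPart K m m = 1 := by
  induction m with
  | zero => rfl
  | succ m ih =>
    rw [leftPart, ih, leftPart_eq_zero K (by omega)]
    simp

theorem comul_cmGen (m : ℕ) : comul K (cmGen K (m + 1)) = cmGen K (m + 1) ⊗ₜ[K] 1 +
    ∑ i ∈ Finset.range (m + 1), aevalCM K (leftPart K m i) ⊗ₜ[K] cmGen K (i + 1) := by
  induction m with
  | zero => simp [cmGen, comul_bullet, leftPart]
  | succ m ih =>
    have hg : ∀ i, growthTensor K (aevalCM K (leftPart K m i) ⊗ₜ[K] cmGen K (i + 1)) =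
        aevalCM K (shift K (leftPart K m i) + ((i : K) + 1) •
          (MvPolynomial.X 1 * leftPart K m i)) ⊗ₜ[K] cmGen K (i + 1) +
        aevalCM K (leftPart K m i) ⊗ₜ[K] cmGen K (i + 2) := by
      intro i
      rw [growthTensor_tmul, grading_cmGen, map_add, map_smul, map_mul, aevalCM_X_one,
        aevalCM_shift, TensorProduct.add_tmul, cmGen_succ_succ, TensorProduct.tmul_smul,
        TensorProduct.smul_tmul']
      abel
    -- A vanishing summand at `i = m + 1` extends the first sum, so that splitting off `i = 0`
    -- aligns it with the shifted sum.
    have h0 : aevalCM K (shift K (leftPart K m (m + 1)) + (((m + 1 : ℕ) : K) + 1) •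
        (MvPolynomial.X 1 * leftPart K m (m + 1))) ⊗ₜ[K] cmGen K (m + 1 + 1) = 0 := by
      rw [leftPart_eq_zero K (Nat.lt_succ_self m)]
      simp
    rw [cmGen_succ_succ, comul_growth, ih, map_add, map_sum, Finset.sum_congr rfl fun i _ => hg i,
      Finset.sum_add_distrib, ← add_zero (Finset.sum (Finset.range (m + 1)) _), ← h0,
      ← Finset.sum_range_succ fun i => aevalCM K (shift K (leftPart K m i) + ((i : K) + 1) •
          (MvPolynomial.X 1 * leftPart K m i)) ⊗ₜ[K] cmGen K (i + 1),
      Finset.sum_range_succ' _ (m + 1), Finset.sum_range_succ' _ (m + 1), growthTensor_tmul,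
      add_right_comm (Finset.sum _ _), ← Finset.sum_add_distrib]
    simp only [← TensorProduct.add_tmul, ← map_add, leftPart, Derivation.map_one_eq_zero,
      TensorProduct.tmul_zero, add_zero]
    congr 2
    · refine Finset.sum_congr rfl fun i _ => ?_
      congr 2
      push_cast
      rw [add_right_comm, add_assoc (i : K), one_add_one_eq_two]
    · simp

theorem shift_mem (b : MvPolynomial ℕ+ K) : shift K b ∈ MvPolynomial.idealOfVars ℕ+ K := by
  induction b using MvPolynomial.induction_on with
  | C r => rw [MvPolynomial.derivation_C]; exact zero_mem _
  | add p q hp hq => rw [map_add]; exact add_mem hp hq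
  | mul_X p n hp =>
    rw [Derivation.leibniz, shift_X]
    exact add_mem (Ideal.mul_mem_left _ _ (Ideal.subset_span ⟨_, rfl⟩))
      (Ideal.mul_mem_left _ _ hp)

/-- This allows the recursion of `leftPart` to be carried out modulo the square of the ideal. -/
theorem shift_mem_sq {b : MvPolynomial ℕ+ K} (hb : b ∈ MvPolynomial.idealOfVars ℕ+ K ^ 2) :
    shift K b ∈ MvPolynomial.idealOfVars ℕ+ K ^ 2 := by
  rw [pow_two] at hb ⊢
  induction hb using Submodule.mul_induction_on' with
  | mem_mul_mem p hp q hq =>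
    rw [Derivation.leibniz, smul_eq_mul, smul_eq_mul]
    exact add_mem (Ideal.mul_mem_mul hp (shift_mem K q)) (Ideal.mul_mem_mul hq (shift_mem K p))
  | add p _ q _ hp hq => rw [map_add]; exact add_mem hp hq

/-- The part of `leftPart` that is linear in the variables. -/
theorem leftPart_sub_mem (i k : ℕ) : leftPart K (i + (k + 1)) i -
    ((i + k + 2).choose (k + 2) : K) • MvPolynomial.X k.succPNat ∈
      MvPolynomial.idealOfVars ℕ+ K ^ 2 := by
  have hX : (MvPolynomial.X 1 : MvPolynomial ℕ+ K) ∈ MvPolynomial.idealOfVars ℕ+ K :=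
    Ideal.subset_span ⟨1, rfl⟩
  have hXX : ∀ n : ℕ+, (MvPolynomial.X 1 * MvPolynomial.X n : MvPolynomial ℕ+ K) ∈
      MvPolynomial.idealOfVars ℕ+ K ^ 2 := fun n => by
    rw [pow_two]
    exact Ideal.mul_mem_mul hX (Ideal.subset_span ⟨n, rfl⟩)
  have hsmul : ∀ (c : K) {b : MvPolynomial ℕ+ K}, b ∈ MvPolynomial.idealOfVars ℕ+ K ^ 2 →
      c • b ∈ MvPolynomial.idealOfVars ℕ+ K ^ 2 := fun c b hb => by
    rw [MvPolynomial.smul_eq_C_mul]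
    exact Ideal.mul_mem_left _ _ hb
  obtain ⟨m, hm⟩ : ∃ m, m = i + k := ⟨_, rfl⟩
  induction m generalizing i k with
  | zero =>
    obtain ⟨rfl, rfl⟩ : i = 0 ∧ k = 0 := by omega
    simp only [leftPart, zero_add]
    refine (congrArg (· ∈ MvPolynomial.idealOfVars ℕ+ K ^ 2)
      (?_ : _ = (0 : MvPolynomial ℕ+ K))).mpr (zero_mem _)
    simp only [Derivation.map_one_eq_zero, mul_one, zero_add, Nat.choose_self, Nat.cast_one,
      one_smul, sub_eq_zero]
    rfl
  | succ m ih =>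
    match i, k with
    | 0, k + 1 =>
      obtain rfl : m = k := by omega
      have h := ih 0 m (by omega)
      simp only [zero_add, Nat.choose_self, Nat.cast_one, one_smul] at h ⊢
      have h1 := add_mem (add_mem (shift_mem_sq K h) (Ideal.mul_mem_left _ (MvPolynomial.X 1) h))
        (hXX m.succPNat)
      convert h1 using 1
      rw [leftPart, map_sub, shift_X, show m.succPNat + 1 = (m + 1).succPNat from rfl]
      ring
    -- Only next to the diagonal is the `T₁` term linear, because `leftPart` is `1` there; it
    -- supplies the `i + 2` in Pascal's rule.
    | i + 1, 0 =>
      have h := ih i 0 (by omega)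
      convert h using 1
      rw [show i + 1 + (0 + 1) = i + 1 + 1 from rfl, leftPart, leftPart_self, mul_one,
        Derivation.map_one_eq_zero, zero_add, show Nat.succPNat 0 = 1 from rfl,
        show i + 1 + 0 + 2 = i + 0 + 2 + 1 by ring, Nat.choose_succ_succ' (i + 0 + 2) 1,
        Nat.choose_one_right]
      push_cast
      simp only [add_zero, add_smul]
      abel
    -- Here the `T₁` term is quadratic, and the two remaining terms add up by Pascal's rule.
    | i + 1, k + 1 =>
      have h := ih i (k + 1) (by omega)
      have h' := ih (i + 1) k (by omega)
      have h1 := add_mem (add_mem (shift_mem_sq K h') h)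
        (hsmul ((i : K) + 2) (add_mem (Ideal.mul_mem_left _ (MvPolynomial.X 1) h')
          (hsmul ((i + 1 + k + 2).choose (k + 2) : K) (hXX k.succPNat))))
      convert h1 using 1
      rw [show i + 1 + (k + 1 + 1) = (i + (k + 1 + 1)) + 1 by ring, leftPart,
        show i + 1 + (k + 1) = i + (k + 1 + 1) by ring, map_sub, Derivation.map_smul, shift_X,
        show k.succPNat + 1 = (k + 1).succPNat from rfl,
        show i + (k + 1 + 1) + 2 = i + 1 + k + 2 + 1 by ring, Nat.choose_succ_succ',
        show i + (k + 1) + 2 = i + 1 + k + 2 by ring, mul_sub, mul_smul_comm, sub_add_cancel, Nat.cast_add]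
      simp only [add_smul]
      abel

/-! ### The array of coefficients -/

theorem coeffTensor_tmul (j i : ℕ+) (a b : MvPolynomial ℕ+ K) :
    coeffTensor j i (a ⊗ₜ[K] b) = MvPolynomial.coeff (Finsupp.single j 1) a *
      MvPolynomial.coeff (Finsupp.single i 1) b := by
  simp [coeffTensor]

theorem coeff_leftPart (i : ℕ) (j : ℕ+) :
    MvPolynomial.coeff (Finsupp.single j 1) (leftPart K (i + j) i) =
      ((i + j + 1).choose (j + 1) : K) := by
  obtain ⟨k, rfl⟩ : ∃ k : ℕ, j = k.succPNat := ⟨j.natPred, (PNat.succPNat_natPred j).symm⟩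
  have h := (MvPolynomial.mem_pow_idealOfVars_iff' 2 _).1 (leftPart_sub_mem K i k)
    (Finsupp.single k.succPNat 1) (by simp)
  rw [MvPolynomial.coeff_sub, sub_eq_zero] at h
  simp only [Nat.succPNat_coe, Nat.succ_eq_add_one]
  rw [h, MvPolynomial.coeff_smul, MvPolynomial.coeff_X, if_pos rfl, smul_eq_mul, mul_one]
  rfl

theorem hasLambdaArray_cmGen : HasLambdaArray (fun n : ℕ+ => cmGen K n)
    (fun i j => (Nat.choose ((i : ℕ) + j) ((j : ℕ) + 1) : K)) := by
  classical
  intro n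
  obtain ⟨m, rfl⟩ : ∃ m : ℕ, n = m.succPNat := ⟨n.natPred, (PNat.succPNat_natPred n).symm⟩
  refine ⟨MvPolynomial.X m.succPNat ⊗ₜ 1 + ∑ i ∈ Finset.range (m + 1),
    leftPart K m i ⊗ₜ MvPolynomial.X i.succPNat, ?_, ?_⟩
  · rw [map_add, map_sum]
    simp only [Algebra.TensorProduct.map_tmul, map_one]
    refine Eq.trans ?_ (comul_cmGen K m).symm
    change aevalCM K _ ⊗ₜ[K] 1 + ∑ i ∈ _, aevalCM K _ ⊗ₜ[K] aevalCM K _ = _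
    simp only [aevalCM_X]
  · intro i j hij
    obtain ⟨i, rfl⟩ : ∃ k : ℕ, i = k.succPNat := ⟨i.natPred, (PNat.succPNat_natPred i).symm⟩
    have hm : m = i + j := by
      have := congrArg PNat.val hij
      simp only [PNat.add_coe, Nat.succPNat_coe] at this
      omega
    rw [map_add, map_sum, Finset.sum_eq_single i]
    · rw [coeffTensor_tmul, coeffTensor_tmul, hm, coeff_leftPart, MvPolynomial.coeff_X (i := i.succPNat),
        if_pos rfl, MvPolynomial.coeff_one, if_neg (by simp [eq_comm]), mul_zero, zero_add, mul_one,
        add_right_comm]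
      rfl
    · intro k _ hk
      rw [coeffTensor_tmul, MvPolynomial.coeff_X, if_neg, mul_zero]
      intro h
      exact hk (Nat.succPNat_injective (Finsupp.single_left_injective one_ne_zero h))
    · intro h
      exact absurd (Finset.mem_range.2 (by omega)) h

end HCK

/-! ### Feynman rules -/

namespace FeynmanRules

variable {K : Type*} [Field K]

theorem lid_map_coeff_zero_mul (x : Polynomial K ⊗[K] Polynomial K) :
    TensorProduct.lid K _ (TensorProduct.map (Polynomial.lcoeff K 0) LinearMap.id
      (x * (Polynomial.X ⊗ₜ[K] 1 + 1 ⊗ₜ[K] Polynomial.X))) =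
    TensorProduct.lid K _ (TensorProduct.map (Polynomial.lcoeff K 0) LinearMap.id x) *
      Polynomial.X := by
  induction x using TensorProduct.induction_on with
  | zero => simp
  | add x y hx hy => rw [add_mul, map_add, map_add, hx, hy, map_add, map_add, add_mul]
  | tmul a b => simp [mul_add]

theorem lid_map_coeff_one_mul (x : Polynomial K ⊗[K] Polynomial K) :
    TensorProduct.lid K _ (TensorProduct.map (Polynomial.lcoeff K 1) LinearMap.id
      (x * (Polynomial.X ⊗ₜ[K] 1 + 1 ⊗ₜ[K] Polynomial.X))) =
    TensorProduct.lid K _ (TensorProduct.map (Polynomial.lcoeff K 1) LinearMap.id x) *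
      Polynomial.X +
    TensorProduct.lid K _ (TensorProduct.map (Polynomial.lcoeff K 0) LinearMap.id x) := by
  induction x using TensorProduct.induction_on with
  | zero => simp
  | add x y hx hy =>
    simp only [add_mul, map_add, hx, hy]
    abel
  | tmul a b => simp [mul_add, add_comm]

theorem polyComul_X_pow_succ (n : ℕ) : polyComul K (Polynomial.X ^ (n + 1)) =
    polyComul K (Polynomial.X ^ n) * (Polynomial.X ⊗ₜ[K] 1 + 1 ⊗ₜ[K] Polynomial.X) := by
  rw [pow_succ, map_mul]
  simp [polyComul]

theorem lid_map_coeff_zero_polyComul_X_pow (n : ℕ) :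
    TensorProduct.lid K _ (TensorProduct.map (Polynomial.lcoeff K 0) LinearMap.id
      (polyComul K (Polynomial.X ^ n))) = Polynomial.X ^ n := by
  induction n with
  | zero => simp [Algebra.TensorProduct.one_def]
  | succ n ih => rw [polyComul_X_pow_succ, lid_map_coeff_zero_mul, ih, pow_succ]

/-- The part of `f(L ⊗ 1 + 1 ⊗ L)` linear in `L ⊗ 1` is the first-order Taylor term. -/
theorem lid_map_coeff_one_polyComul (f : Polynomial K) :
    TensorProduct.lid K _ (TensorProduct.map (Polynomial.lcoeff K 1) LinearMap.id
      (polyComul K f)) = Polynomial.derivative f := by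
  have hpow : ∀ n : ℕ, TensorProduct.lid K _ (TensorProduct.map (Polynomial.lcoeff K 1)
      LinearMap.id (polyComul K (Polynomial.X ^ n))) =
        Polynomial.derivative (Polynomial.X ^ n) := by
    intro n
    induction n with
    | zero => simp [Algebra.TensorProduct.one_def, Polynomial.coeff_one]
    | succ n ih =>
      rw [polyComul_X_pow_succ, lid_map_coeff_one_mul, ih, lid_map_coeff_zero_polyComul_X_pow,
        pow_succ, Polynomial.derivative_mul, Polynomial.derivative_X, mul_one]
  induction f using Polynomial.induction_on' with
  | add p q hp hq => simp only [map_add, hp, hq]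
  | monomial n c =>
    rw [← mul_one c, ← smul_eq_mul, ← Polynomial.smul_monomial, Polynomial.monomial_one_right_eq_X_pow,
      map_smul, map_smul, map_smul, Polynomial.derivative_smul, hpow]

variable (φ : FeynmanRules K)

theorem coeff_zero_cmGen (n : ℕ) : (φ.toAlgHom (HCK.cmGen K (n + 1))).coeff 0 = 0 := by
  rw [Polynomial.coeff_zero_eq_eval_zero, φ.map_counit, HCK.counit_cmGen]

theorem coeff_zero_of_mem {b : MvPolynomial ℕ+ K} (hb : b ∈ MvPolynomial.idealOfVars ℕ+ K) :
    (φ.toAlgHom (HCK.aevalCM K b)).coeff 0 = 0 := by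
  have h : MvPolynomial.idealOfVars ℕ+ K ≤ RingHom.ker
      (Polynomial.constantCoeff.comp ((φ.toAlgHom.comp (HCK.aevalCM K)) : _ →+* Polynomial K)) := by
    rw [MvPolynomial.idealOfVars, Ideal.span_le]
    rintro _ ⟨n, rfl⟩
    obtain ⟨m, rfl⟩ : ∃ m : ℕ, n = m.succPNat := ⟨n.natPred, (PNat.succPNat_natPred n).symm⟩
    change (φ.toAlgHom (HCK.aevalCM K (MvPolynomial.X m.succPNat))).coeff 0 = 0
    rw [HCK.aevalCM_X, coeff_zero_cmGen]
  exact h hb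

/-- Generators map to polynomials without constant term, so products of two have no linear term.
Hence only the linear part of `leftPart` matters. -/
theorem coeff_one_of_mem_sq {b : MvPolynomial ℕ+ K}
    (hb : b ∈ MvPolynomial.idealOfVars ℕ+ K ^ 2) :
    (φ.toAlgHom (HCK.aevalCM K b)).coeff 1 = 0 := by
  rw [pow_two] at hb
  induction hb using Submodule.mul_induction_on' with
  | mem_mul_mem p hp q hq =>
    rw [map_mul, map_mul, Polynomial.mul_coeff_one, coeff_zero_of_mem φ hp,
      coeff_zero_of_mem φ hq, zero_mul, mul_zero, add_zero]
  | add p _ q _ hp hq => rw [map_add, map_add, Polynomial.coeff_add, hp, hq, add_zero]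

theorem coeff_one_leftPart {m i : ℕ} (hi : i ≤ m) :
    (φ.toAlgHom (HCK.aevalCM K (HCK.leftPart K m i))).coeff 1 =
      ((m + 1).choose (m - i + 1) : K) * (φ.toAlgHom (HCK.cmGen K (m - i))).coeff 1 := by
  obtain ⟨k, rfl⟩ := Nat.exists_eq_add_of_le hi
  rw [Nat.add_sub_cancel_left]
  cases k with
  -- For `m = i` both sides vanish, since `leftPart` and `t₀` are both `1`.
  | zero => simp [HCK.leftPart_self, HCK.cmGen, Polynomial.coeff_one]
  | succ k =>
    have h := coeff_one_of_mem_sq φ (HCK.leftPart_sub_mem K i k)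
    rw [map_sub, map_sub, Polynomial.coeff_sub, sub_eq_zero, map_smul, map_smul, HCK.aevalCM_X,
      Polynomial.coeff_smul, smul_eq_mul] at h
    exact h

theorem derivative_cmGen (n : ℕ) : Polynomial.derivative (φ.toAlgHom (HCK.cmGen K n)) =
    Polynomial.C ((φ.toAlgHom (HCK.cmGen K n)).coeff 1) +
      ∑ x ∈ Finset.HasAntidiagonal.antidiagonal n, Polynomial.C ((n.choose (x.2 + 1) : K) *
        (φ.toAlgHom (HCK.cmGen K x.2)).coeff 1) * φ.toAlgHom (HCK.cmGen K x.1) := by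
  cases n with
  | zero => simp [HCK.cmGen, Polynomial.coeff_one]
  | succ m =>
    have h := congrArg (fun x => TensorProduct.lid K _ (TensorProduct.map (Polynomial.lcoeff K 1)
      LinearMap.id x)) (φ.map_comul (HCK.cmGen K (m + 1)))
    simp only [lid_map_coeff_one_polyComul] at h
    rw [← h, HCK.comul_cmGen, Finset.Nat.sum_antidiagonal_eq_sum_range_succ
      (fun i j => Polynomial.C (((m + 1).choose (j + 1) : K) *
        (φ.toAlgHom (HCK.cmGen K j)).coeff 1) * φ.toAlgHom (HCK.cmGen K i)),
      Finset.sum_range_succ' _ (m + 1)]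
    simp only [map_add, map_sum, Algebra.TensorProduct.map_tmul, TensorProduct.map_tmul,
      TensorProduct.lid_tmul, Polynomial.lcoeff_apply, LinearMap.id_apply, map_one]
    -- The `t₀` term of the antidiagonal sum carries `C(m+1, m+2) = 0`; the contribution of `t_{m+1}
    -- ⊗ 1` is the separate constant.
    rw [Nat.sub_zero, Nat.choose_succ_self, Nat.cast_zero, zero_mul, Polynomial.C_0, zero_mul,
      add_zero, Polynomial.smul_eq_C_mul, mul_one]
    congr 1
    refine Finset.sum_congr rfl fun i hi => ?_
    rw [coeff_one_leftPart φ (by simpa [Nat.lt_succ_iff] using hi), Nat.add_sub_add_right,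
      Polynomial.smul_eq_C_mul]

theorem no_rge [CharZero K] (hne : ∃ n : ℕ, 1 ≤ n ∧ φ.toAlgHom (HCK.cmGen K n) ≠ 0)
    (β γ γ₀ : PowerSeries K) : ¬ IsRGESolution β γ γ₀ (greenFunction φ (HCK.cmSeries K)) := by
  have hG : greenFunction φ (HCK.cmSeries K) =
      PowerSeries.mk fun n => φ.toAlgHom (HCK.cmGen K n) := by
    ext1 n
    simp [greenFunction, HCK.cmSeries]
  rw [hG]
  refine RGEObstruction.no_rge_polynomial (by simp [HCK.cmGen]) (fun n hn => ?_) hne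
    φ.derivative_cmGen β γ γ₀
  obtain ⟨m, rfl⟩ : ∃ m, n = m + 1 := ⟨n - 1, by omega⟩
  exact φ.coeff_zero_cmGen m

end FeynmanRules
end

theorem mainTheorem6 (K : Type*) [Field K] [CharZero K] :
    AlgebraicIndependent K (fun n : ℕ+ => HCK.cmGen K n) ∧
    HCK.HasLambdaArray (fun n : ℕ+ => HCK.cmGen K n)
      (fun i j => (Nat.choose ((i : ℕ) + j) ((j : ℕ) + 1) : K)) ∧
    ∀ φ : FeynmanRules K, (∃ n : ℕ, 1 ≤ n ∧ φ.toAlgHom (HCK.cmGen K n) ≠ 0) →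
      ¬ ∃ β γ γ₀ : PowerSeries K,
        IsRGESolution β γ γ₀ (greenFunction φ (HCK.cmSeries K)) :=
  ⟨HCK.algebraicIndependent_cmGen K, HCK.hasLambdaArray_cmGen K,
    fun φ hne ⟨β, γ, γ₀, h⟩ => φ.no_rge hne β γ γ₀ h⟩
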